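/- Let $C:\{0,1\}^n\to\mathbb{N}_0$ be an objective function with maximum $C_{\max}$ and average $C_{\mathrm{avg}}=2^{-n}\sum_x C(x)$. Put $H_C=\sum_x C(x)|x\rangle\langle x|$, $H_1=C_{\max}\mathbb{1}-H_C$ and $H_{\mathrm{TF}}=\frac n2\mathbb{1}-\frac12\sum_{j=1}^n X_j$, and let $\|\cdot\|$ be the spectral norm. Fix $k,l\in\mathbb{N}$ and reals $a>0$ and $b$. Call $C$ *admissible with $m$ terms* if $$H_C=c_0\mathbb{1}-\sum_{\nu=1}^m\alpha_\nu\prod_{j\in S_\nu}Z_j$$ with $c_0\in\mathbb{R}$, distinct nonempty sets $S_\nu\subseteq\{1,\dots,n\}$ of size at most $k$, every qubit in at most $l$ of the $S_\nu$, and real weights with $a\le|\alpha_\nu|\le b$ (that is, $H_C$ is $k$-local with bounded occurrence and terms of norm $\Theta(1)$). For angles $\beta,\gamma\in\mathbb{R}^p$ let $\psi_p=e^{-i\beta_pH_{\mathrm{TF}}}e^{-i\gamma_pH_1}\cdots e^{-i\beta_1H_{\mathrm{TF}}}e^{-i\gamma_1H_1}|+\rangle^{\otimes n}$ be the state after $p$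 rounds of the QAOA, let $\lambda=\langle\psi_p|H_C|\psi_p\rangle/C_{\max}$ be its approximation ratio, and let $$L(\psi_p)=\frac{\langle\psi_p|H_{\mathrm{TF}}|\psi_p\rangle+\lambda C_{\max}-C_{\mathrm{avg}}}{4\pi\,\|[H_C,H_{\mathrm{TF}}]\|}$$ be the lower bound on the number of rounds. (Convention: a quotient with denominator $0$ is $0$; $[H_C,H_{\mathrm{TF}}]=0$ happens only for $m=0$, that is, for constant $C$.) Then there are constants $c,B,c'>0$ that depend only on $k,l,a,b$ such that, for all $n$, $m$ and all admissible $C$ with $m$ terms, 1. $\|[H_C,H_{\mathrm{TF}}]\|\ge c\,m$, $\;C_{\max}-C_{\mathrm{avg}}\le B\,m\;$ and $\;\|[H_C,H_{\mathrm{TF}}]\|\ge c'\,(C_{\max}-C_{\mathrm{avg}})$; 2. $\dfrac{C_{\max}-C_{\mathrm{avg}}}{4\pi\|[H_C,H_{\mathrm{TF}}]\|}<1$, so the round lower bound, with the contribution of $H_{\mathrm{TF}}$ neglected, is trivial; 3. $p\ge L(\psi_p)$ for every $p$ and all angles. Moreover, for every $\delta>0$ there is a constant $K$ that depends only on $k,l,a,b,\delta$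 such that $L(\psi_p)\le K$ for all $n$, $m$, all admissible $C$ with $m$ terms and $C_{\max}-C_{\mathrm{avg}}\ge\delta n$, every $p$ and all angles; that is, the full lower bound on the number of rounds is $O(1)$. -/

import Mathlib

open scoped Matrix

noncomputable section

namespace QAOA

/-- Bit strings of length `n`; they index the computational basis of `n` qubits. -/
abbrev Bits (n : ℕ) := Fin n → Fin 2

/-- Linear operators on `n` qubits, as matrices in the computational basis. -/
abbrev Op (n : ℕ) := Matrix (Bits n) (Bits n) ℂ

/-- The Pauli matrix `X`. -/
def sigmaX : Matrix (Fin 2) (Fin 2) ℂ := !![0, 1; 1, 0]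

/-- The Pauli matrix `Z`. -/
def sigmaZ : Matrix (Fin 2) (Fin 2) ℂ := !![1, 0; 0, -1]

/-- The tensor product `A 0 ⊗ A 1 ⊗ ⋯ ⊗ A (n-1)` of one-qubit operators. -/
def tensor {n : ℕ} (A : Fin n → Matrix (Fin 2) (Fin 2) ℂ) : Op n :=
  Matrix.of fun x y => ∏ i, A i (x i) (y i)

/-- `X_j`: Pauli `X` on qubit `j`, the identity on the other qubits. -/
def pauliX {n : ℕ} (j : Fin n) : Op n :=
  tensor fun i => if i = j then sigmaX else 1

/-- `∏_{j ∈ S} Z_j`: Pauli `Z` on the qubits of `S`, the identity on the other qubits. -/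
def pauliZ {n : ℕ} (S : Finset (Fin n)) : Op n :=
  tensor fun i => if i ∈ S then sigmaZ else 1

/-- The spectral norm: the operator norm with respect to the Euclidean norm. -/
def specNorm {n : ℕ} (A : Op n) : ℝ := ‖Matrix.toEuclideanCLM (𝕜 := ℂ) A‖

/-- `C_max`, the largest objective value. -/
def costMax {n : ℕ} (C : Bits n → ℕ) : ℝ := ((Finset.univ.sup C : ℕ) : ℝ)

/-- `C_avg`, the average of the objective values over all `2 ^ n` bit strings. -/
def costAvg {n : ℕ} (C : Bits n → ℕ) : ℝ := (∑ x, (C x : ℝ)) / 2 ^ n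

/-- The cost Hamiltonian `H_C = ∑ z, C(z) |z⟩⟨z|`. -/
def costHam {n : ℕ} (C : Bits n → ℕ) : Op n := Matrix.diagonal fun x => (C x : ℂ)

/-- The problem Hamiltonian `H_1 = C_max 𝟙 - H_C` (the phase separator). -/
def problemHam {n : ℕ} (C : Bits n → ℕ) : Op n := ((costMax C : ℝ) : ℂ) • (1 : Op n) - costHam C

/-- The transverse-field mixer `H_TF = (n/2) 𝟙 - (1/2) ∑ j, X_j`. -/
def mixerTF (n : ℕ) : Op n :=
  ((n : ℂ) / 2) • (1 : Op n) - (1 / 2 : ℂ) • ∑ j : Fin n, pauliX j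

/-- `‖[H_C, H_TF]‖` in spectral norm. -/
def commNorm {n : ℕ} (C : Bits n → ℕ) : ℝ :=
  specNorm (costHam C * mixerTF n - mixerTF n * costHam C)

/-- The unitary `e^{-i t H}`. -/
def evolve {n : ℕ} (H : Op n) (t : ℝ) : Op n := NormedSpace.exp ((-(Complex.I * (t : ℂ))) • H)

/-- The initial state `|+⟩^{⊗ n}`. -/
def plusState (n : ℕ) : Bits n → ℂ := fun _ => ((1 / Real.sqrt (2 ^ n) : ℝ) : ℂ)

/-- The state after `p` rounds of the QAOA with phase separator `H_1`, mixer `H_TF` and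
angles `β`, `γ`, started in `|+⟩^{⊗ n}`. -/
def qaoaState {n : ℕ} (C : Bits n → ℕ) : (p : ℕ) → (Fin p → ℝ) → (Fin p → ℝ) → (Bits n → ℂ)
  | 0, _, _ => plusState n
  | p + 1, β, γ =>
      evolve (mixerTF n) (β (Fin.last p)) *ᵥ
        (evolve (problemHam C) (γ (Fin.last p)) *ᵥ
          qaoaState C p (fun i => β i.castSucc) (fun i => γ i.castSucc))

/-- The expectation value `⟨ψ|A|ψ⟩` (real for Hermitian `A`). -/
def expect {n : ℕ} (A : Op n) (ψ : Bits n → ℂ) : ℝ := (star ψ ⬝ᵥ (A *ᵥ ψ)).re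

/-- The approximation ratio `λ = ⟨ψ|H_C|ψ⟩ / C_max` of a state. -/
def approxRatio {n : ℕ} (C : Bits n → ℕ) (ψ : Bits n → ℂ) : ℝ :=
  expect (costHam C) ψ / costMax C

/-- The lower bound on the number of QAOA rounds (transverse-field mixer) for reaching the
state `ψ`: `(⟨ψ|H_TF|ψ⟩ + λ C_max - C_avg) / (4 π ‖[H_C, H_TF]‖)`. -/
def roundBound {n : ℕ} (C : Bits n → ℕ) (ψ : Bits n → ℂ) : ℝ :=
  (expect (mixerTF n) ψ + approxRatio C ψ * costMax C - costAvg C) /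
    (4 * Real.pi * commNorm C)

/-- `H_C` is a `k`-local Hamiltonian of occurrence at most `l`: up to a multiple of the
identity it is a weighted sum of `m` distinct nontrivial products of at most `k` Pauli `Z`
operators, every qubit occurs in at most `l` of the products, and all the weights have
absolute value in `[a, b]`. -/
def IsBoundedOccurrenceLocal (k l : ℕ) (a b : ℝ) {n : ℕ} (m : ℕ) (C : Bits n → ℕ) : Prop :=
  ∃ (S : Fin m → Finset (Fin n)) (α : Fin m → ℝ) (c₀ : ℝ),
    Function.Injective S ∧
    (∀ ν, (S ν).Nonempty ∧ (S ν).card ≤ k) ∧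
    (∀ j, (Finset.univ.filter fun ν => j ∈ S ν).card ≤ l) ∧
    (∀ ν, a ≤ |α ν| ∧ |α ν| ≤ b) ∧
    costHam C = (c₀ : ℂ) • (1 : Op n) - ∑ ν, (α ν : ℂ) • pauliZ (S ν)

end QAOA

end

/-!
The argument combines a quantum speed limit with a Fourier-analytic lower bound on the gap
`C_max - C_avg`. Write `N = ‖[H_C, H_TF]‖`.

*Speed limit.* Under `e^{-itH}` the expectation value of an observable `A` changes by at most
`|t| ‖[H, A]‖` (`abs_expect_evolve_sub_le`). The mixer is a sum of commuting projections and the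
phase separator is diagonal with integer entries, so both evolutions are `2π`-periodic and `|t|` can
be replaced by `π` (`abs_expect_evolve_sub_le_pi`). In a round of the QAOA only the phase separator
changes `⟨H_TF⟩` and only the mixer changes `⟨H_C⟩`. Starting from `0` and `C_avg`, the sum
`⟨H_TF⟩ + ⟨H_C⟩ - C_avg` is therefore at most `2π p N` after `p` rounds (`expect_qaoaState_le`),
which is the bound `L(ψ_p) ≤ p`.

*Quarter turn.* A mixer evolution of time `π / 2` turns a basis state of value `C_max` into a state
with uniform outcome distribution, hence of energy `C_avg`. The speed limit gives
`C_max - C_avg ≤ (π / 2) N` for every objective function (`costMax_sub_costAvg_le`). This makes the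
quotient `(C_max - C_avg) / (4 π N)` at most `1 / 8`, and since `⟨H_TF⟩ ≤ n` it bounds the full
round bound by a constant whenever `C_max - C_avg ≥ δ n` (`roundBound_le_of_gap`).

*Gap.* It remains to see that the gap is of order `m`. The upper bound is the triangle inequality.
For the lower bound, bounded locality and occurrence allow the selection of a positive fraction of
the terms such that no term meets two selected ones (`exists_sparse_subfamily`). The Riesz product
of the selected characters is a nonnegative weight of mean one that correlates with precisely the
selected terms (`sum_parity_mul_rieszProduct`). With the right signs, the weighted average of `C`
exceeds `C_avg` by the sum of the selected `|α_ν|`, which is at least a constant times `m`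
(`sum_abs_le_costMax_sub_costAvg`), and `N` inherits this bound from the quarter turn.
-/

namespace QAOA

/-! ### Unitary evolution and the speed limit -/

/-- Conjugating by a one-parameter group of contractions moves an element `A` with speed at most
the norm of its commutator with the generator. -/
lemma norm_exp_conj_sub_le {𝔸 : Type*} [NormedRing 𝔸] [NormedAlgebra ℝ 𝔸] [CompleteSpace 𝔸]
    (X A : 𝔸) (hX : ∀ u : ℝ, ‖NormedSpace.exp (u • X)‖ ≤ 1) (t : ℝ) :
    ‖NormedSpace.exp ((-t) • X) * A * NormedSpace.exp (t • X) - A‖ ≤ |t| * ‖X * A - A * X‖ := by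
  set E : ℝ → 𝔸 := fun u => NormedSpace.exp (u • X) with hE
  have hdE : ∀ s, HasDerivAt E (X * E s) s := fun s => hasDerivAt_exp_smul_const' X s
  have hd : ∀ s, HasDerivAt (fun s => E (-s) * A * E s)
      (E (-s) * (A * X - X * A) * E s) s := by
    intro s
    have h1 : HasDerivAt (fun s => E (-s)) (-(E (-s) * X)) s := by
      have h0 := (hasDerivAt_exp_smul_const (𝕂 := ℝ) X (-s)).scomp s (hasDerivAt_neg s)
      rw [neg_one_smul] at h0
      exact h0
    have h2 := (h1.mul_const A).mul (hdE s)
    have h3 : E (-s) * (A * X - X * A) * E s =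
        -(E (-s) * X) * A * E s + E (-s) * A * (X * E s) := by
      simp only [mul_sub, sub_mul, neg_mul, mul_assoc, neg_add_eq_sub]
    rw [h3]
    exact h2
  have hb : ∀ s ∈ (Set.univ : Set ℝ), ‖E (-s) * (A * X - X * A) * E s‖ ≤ ‖X * A - A * X‖ := by
    intro s _
    calc _ ≤ ‖E (-s)‖ * ‖A * X - X * A‖ * ‖E s‖ :=
          (norm_mul_le _ _).trans (by gcongr; exact norm_mul_le _ _)
      _ ≤ 1 * ‖A * X - X * A‖ * 1 := by
          gcongr
          · exact hX _
          · exact hX _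
      _ = _ := by rw [one_mul, mul_one, norm_sub_rev]
  have h := convex_univ.norm_image_sub_le_of_norm_hasDerivWithin_le
    (fun s _ => (hd s).hasDerivWithinAt) hb (Set.mem_univ 0) (Set.mem_univ t)
  simp only [hE, neg_zero, zero_smul, NormedSpace.exp_zero, one_mul, mul_one, sub_zero,
    Real.norm_eq_abs] at h
  rw [mul_comm]
  exact h

section Dynamics

open scoped Matrix.Norms.L2Operator

variable {n : ℕ}

lemma specNorm_eq_norm (A : Op n) : specNorm A = ‖A‖ := rfl

lemma specNorm_nonneg (A : Op n) : 0 ≤ specNorm A := norm_nonneg _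

lemma norm_one_op : ‖(1 : Op n)‖ = 1 := CStarRing.norm_one

lemma abs_expect_le_specNorm (A : Op n) {ψ : Bits n → ℂ} (hψ : star ψ ⬝ᵥ ψ = 1) :
    |expect A ψ| ≤ specNorm A := by
  have h1 : star ψ ⬝ᵥ (A *ᵥ ψ) =
      inner ℂ (WithLp.toLp 2 ψ) (Matrix.toEuclideanCLM (𝕜 := ℂ) A (WithLp.toLp 2 ψ)) := by
    rw [EuclideanSpace.inner_eq_star_dotProduct, Matrix.toEuclideanCLM_toLp, dotProduct_comm]
  have h2 : ‖(WithLp.toLp 2 ψ : EuclideanSpace ℂ (Bits n))‖ = 1 := by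
    have h3 : inner ℂ (WithLp.toLp 2 ψ : EuclideanSpace ℂ (Bits n)) (WithLp.toLp 2 ψ) = 1 := by
      rw [EuclideanSpace.inner_eq_star_dotProduct, dotProduct_comm]
      exact hψ
    rw [inner_self_eq_norm_sq_to_K] at h3
    have h4 : ‖(WithLp.toLp 2 ψ : EuclideanSpace ℂ (Bits n))‖ ^ 2 = 1 :=
      Complex.ofReal_injective (by simpa using h3)
    exact (pow_eq_one_iff_of_nonneg (norm_nonneg _) two_ne_zero).1 h4
  calc |expect A ψ| ≤ ‖star ψ ⬝ᵥ (A *ᵥ ψ)‖ := Complex.abs_re_le_norm _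
    _ ≤ ‖(WithLp.toLp 2 ψ : EuclideanSpace ℂ (Bits n))‖ *
        ‖Matrix.toEuclideanCLM (𝕜 := ℂ) A (WithLp.toLp 2 ψ)‖ := by
      rw [h1]; exact norm_inner_le_norm _ _
    _ ≤ specNorm A := by
      have := (Matrix.toEuclideanCLM (𝕜 := ℂ) A).le_opNorm (WithLp.toLp 2 ψ)
      rw [h2, mul_one] at this
      rw [h2, one_mul]
      exact this

lemma evolve_add (H : Op n) (s t : ℝ) : evolve H (s + t) = evolve H s * evolve H t := by
  unfold evolve
  rw [← Matrix.exp_add_of_commute _ _ (((Commute.refl H).smul_left _).smul_right _), ← add_smul]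
  congr 2
  push_cast
  ring

lemma evolve_zero (H : Op n) : evolve H 0 = 1 := by
  simp [evolve]

lemma evolve_neg_mul_self (H : Op n) (t : ℝ) : evolve H (-t) * evolve H t = 1 := by
  rw [← evolve_add, neg_add_cancel, evolve_zero]

lemma evolve_conjTranspose {H : Op n} (hH : H.IsHermitian) (t : ℝ) :
    (evolve H t)ᴴ = evolve H (-t) := by
  unfold evolve
  rw [← Matrix.exp_conjTranspose, Matrix.conjTranspose_smul, hH.eq]
  congr 2
  simp

lemma expect_mulVec (A U : Op n) (ψ : Bits n → ℂ) :
    expect A (U *ᵥ ψ) = expect (Uᴴ * A * U) ψ := by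
  simp only [expect, Matrix.star_mulVec, Matrix.mulVec_mulVec, Matrix.dotProduct_mulVec,
    Matrix.vecMul_vecMul, mul_assoc]

lemma evolve_mulVec_unit {H : Op n} (hH : H.IsHermitian) (t : ℝ) {ψ : Bits n → ℂ}
    (hψ : star ψ ⬝ᵥ ψ = 1) : star (evolve H t *ᵥ ψ) ⬝ᵥ (evolve H t *ᵥ ψ) = 1 := by
  rw [Matrix.star_mulVec, evolve_conjTranspose hH, Matrix.dotProduct_mulVec, Matrix.vecMul_vecMul,
    evolve_neg_mul_self, Matrix.vecMul_one, hψ]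

lemma norm_evolve_le {H : Op n} (hH : H.IsHermitian) (t : ℝ) : ‖evolve H t‖ ≤ 1 := by
  have h := Matrix.l2_opNorm_conjTranspose_mul_self (evolve H t)
  rw [evolve_conjTranspose hH, evolve_neg_mul_self, norm_one_op] at h
  nlinarith [norm_nonneg (evolve H t)]

/-- In the Heisenberg picture an observable `A` moves with speed at most `‖[H, A]‖`. -/
lemma specNorm_heisenberg_sub_le {H : Op n} (hH : H.IsHermitian) (A : Op n) (t : ℝ) :
    specNorm (evolve H (-t) * A * evolve H t - A) ≤ |t| * specNorm (H * A - A * H) := by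
  have h1 : ∀ u : ℝ, u • (-Complex.I • H : Op n) = (-(Complex.I * (u : ℂ))) • H := by
    intro u
    rw [← Complex.coe_smul, smul_smul]
    congr 1
    ring
  have h2 : ∀ u : ℝ, NormedSpace.exp (u • (-Complex.I • H : Op n)) = evolve H u :=
    fun u => by rw [h1, evolve]
  have h := norm_exp_conj_sub_le (-Complex.I • H : Op n) A
    (fun u => by rw [h2]; exact norm_evolve_le hH u) t
  rw [h2, h2, smul_mul_assoc, mul_smul_comm, ← smul_sub, norm_smul] at h
  simpa [specNorm_eq_norm] using h

/-- The quantum speed limit for expectation values. -/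
lemma abs_expect_evolve_sub_le {H : Op n} (hH : H.IsHermitian) (A : Op n) (t : ℝ)
    {ψ : Bits n → ℂ} (hψ : star ψ ⬝ᵥ ψ = 1) :
    |expect A (evolve H t *ᵥ ψ) - expect A ψ| ≤ |t| * specNorm (H * A - A * H) := by
  have h : expect A (evolve H t *ᵥ ψ) - expect A ψ =
      expect (evolve H (-t) * A * evolve H t - A) ψ := by
    rw [expect_mulVec, evolve_conjTranspose hH]
    simp only [expect, Matrix.sub_mulVec, dotProduct_sub, Complex.sub_re]
  rw [h]
  exact (abs_expect_le_specNorm _ hψ).trans (specNorm_heisenberg_sub_le hH A t)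

lemma expect_evolve_of_commute {H A : Op n} (hH : H.IsHermitian) (h : Commute H A) (t : ℝ)
    {ψ : Bits n → ℂ} : expect A (evolve H t *ᵥ ψ) = expect A ψ := by
  have hc : Commute (evolve H (-t)) A := by
    unfold evolve
    exact (h.smul_left _).exp_left
  rw [expect_mulVec, evolve_conjTranspose hH, hc.eq, mul_assoc, evolve_neg_mul_self, mul_one]

/-- If the evolution generated by `H` is `2π`-periodic, every evolution time can be replaced by
one in `[-π, π]`, so the speed limit holds with `π` in place of the time. -/
lemma abs_expect_evolve_sub_le_pi {H : Op n} (hH : H.IsHermitian)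
    (hper : Function.Periodic (evolve H) (2 * Real.pi)) (A : Op n) (t : ℝ)
    {ψ : Bits n → ℂ} (hψ : star ψ ⬝ᵥ ψ = 1) :
    |expect A (evolve H t *ᵥ ψ) - expect A ψ| ≤ Real.pi * specNorm (H * A - A * H) := by
  set k : ℤ := round (t / (2 * Real.pi))
  have hs : evolve H t = evolve H (t - k * (2 * Real.pi)) := (hper.sub_int_mul_eq k).symm
  have hle : |t - k * (2 * Real.pi)| ≤ Real.pi := by
    have h := abs_sub_round (t / (2 * Real.pi))
    have hpi := Real.pi_pos
    have h2 : t - k * (2 * Real.pi) = (t / (2 * Real.pi) - k) * (2 * Real.pi) := by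
      field_simp
    rw [h2, abs_mul, abs_of_pos (by positivity : 0 < 2 * Real.pi)]
    nlinarith
  rw [hs]
  exact (abs_expect_evolve_sub_le hH A _ hψ).trans
    (mul_le_mul_of_nonneg_right hle (specNorm_nonneg _))

end Dynamics

/-! ### Tensor products and the transverse field -/

section Tensor

variable {n : ℕ}

lemma tensor_mul (A B : Fin n → Matrix (Fin 2) (Fin 2) ℂ) :
    tensor A * tensor B = tensor fun i => A i * B i := by
  ext x z
  simp only [tensor, Matrix.mul_apply, Matrix.of_apply, ← Finset.prod_mul_distrib]
  rw [Finset.prod_univ_sum, Fintype.piFinset_univ]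

lemma tensor_one : tensor (fun _ : Fin n => (1 : Matrix (Fin 2) (Fin 2) ℂ)) = 1 := by
  ext x y
  simp only [tensor, Matrix.of_apply, Matrix.one_apply]
  rw [Finset.prod_ite_zero]
  simp [funext_iff]

lemma tensor_conjTranspose (A : Fin n → Matrix (Fin 2) (Fin 2) ℂ) :
    (tensor A)ᴴ = tensor fun i => (A i)ᴴ := by
  ext x y
  simp [tensor, Matrix.conjTranspose_apply]

lemma tensor_single_apply (j : Fin n) (M : Matrix (Fin 2) (Fin 2) ℂ) (x y : Bits n) :
    tensor (fun i => if i = j then M else 1) x y =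
      M (x j) (y j) * ∏ i ∈ {j}ᶜ, (1 : Matrix (Fin 2) (Fin 2) ℂ) (x i) (y i) := by
  simp only [tensor, Matrix.of_apply]
  rw [Fintype.prod_eq_mul_prod_compl j, if_pos rfl]
  congr 1
  refine Finset.prod_congr rfl fun i hi => ?_
  rw [if_neg (by simpa using hi)]

lemma smul_one_add_smul_pauliX (j : Fin n) (u v : ℂ) :
    u • (1 : Op n) + v • pauliX j = tensor fun i => if i = j then u • 1 + v • sigmaX else 1 := by
  have h1 : (1 : Op n) = tensor fun i => if i = j then 1 else 1 := by simp [tensor_one]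
  ext x y
  rw [h1, pauliX]
  simp only [Matrix.add_apply, Matrix.smul_apply, tensor_single_apply, smul_eq_mul]
  ring

lemma pauliX_mul_self (j : Fin n) : pauliX j * pauliX j = 1 := by
  rw [pauliX, tensor_mul, ← tensor_one]
  congr 1
  ext i : 1
  split_ifs
  · ext a b
    fin_cases a <;> fin_cases b <;> simp [sigmaX]
  · simp

lemma pauliX_commute (i j : Fin n) : Commute (pauliX i) (pauliX j) := by
  rw [Commute, SemiconjBy, pauliX, pauliX, tensor_mul, tensor_mul]
  congr 1
  ext r : 1
  split_ifs <;> simp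

lemma pauliX_isHermitian (j : Fin n) : (pauliX j).IsHermitian := by
  rw [Matrix.IsHermitian, pauliX, tensor_conjTranspose]
  congr 1
  ext i : 1
  split_ifs
  · ext a b
    fin_cases a <;> fin_cases b <;> simp [sigmaX]
  · simp

open scoped Matrix.Norms.L2Operator in
lemma specNorm_pauliX_le (j : Fin n) : specNorm (pauliX j) ≤ 1 := by
  have h := Matrix.l2_opNorm_conjTranspose_mul_self (pauliX j)
  rw [(pauliX_isHermitian j).eq, pauliX_mul_self, norm_one_op] at h
  rw [specNorm_eq_norm]
  nlinarith [norm_nonneg (pauliX j)]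

/-- The projection `(1 - X_j) / 2` onto the state `|-⟩` of qubit `j`. -/
noncomputable def minusProj (j : Fin n) : Op n := (1 / 2 : ℂ) • (1 : Op n) - (1 / 2 : ℂ) • pauliX j

lemma mixerTF_eq_sum : mixerTF n = ∑ j, minusProj j := by
  simp only [mixerTF, minusProj, Finset.sum_sub_distrib, Finset.sum_const, Finset.card_univ,
    Fintype.card_fin, Finset.smul_sum]
  congr 1
  rw [← Nat.cast_smul_eq_nsmul ℂ, smul_smul]
  congr 1
  ring

lemma minusProj_isIdempotentElem (j : Fin n) : IsIdempotentElem (minusProj j) := by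
  simp only [IsIdempotentElem, minusProj, sub_mul, mul_sub, smul_mul_smul_comm, one_mul, mul_one,
    pauliX_mul_self]
  module

lemma minusProj_commute (i j : Fin n) : Commute (minusProj i) (minusProj j) :=
  Commute.sub_left
    ((Commute.sub_right ((Commute.one_left _).smul_right _)
      ((Commute.one_left _).smul_right _)).smul_left _)
    ((Commute.sub_right ((Commute.one_right _).smul_right _)
      ((pauliX_commute i j).smul_right _)).smul_left _)

lemma mixerTF_isHermitian : (mixerTF n).IsHermitian := by
  rw [Matrix.IsHermitian, mixerTF, Matrix.conjTranspose_sub, Matrix.conjTranspose_smul,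
    Matrix.conjTranspose_smul, Matrix.conjTranspose_sum, Matrix.conjTranspose_one]
  simp [(pauliX_isHermitian _).eq]

open scoped Matrix.Norms.L2Operator in
lemma specNorm_mixerTF_le : specNorm (mixerTF n) ≤ n := by
  have hj : ∀ j : Fin n, ‖minusProj j‖ ≤ 1 := by
    intro j
    have hX := specNorm_pauliX_le j
    rw [specNorm_eq_norm] at hX
    refine (norm_sub_le _ _).trans ?_
    rw [norm_smul, norm_smul, norm_one_op]
    norm_num
    linarith
  rw [specNorm_eq_norm, mixerTF_eq_sum]
  refine (norm_sum_le_of_le _ fun j _ => hj j).trans ?_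
  simp

end Tensor

/-! ### Explicit evolutions and the quarter turn -/

section Evolution

variable {n : ℕ}

open scoped Matrix.Norms.L2Operator in
/-- All positive powers of `P` agree, so the exponential series is scalar on the range of `P` and
trivial on that of `1 - P`. -/
lemma exp_smul_of_isIdempotentElem {P : Op n} (hP : IsIdempotentElem P) (z : ℂ) :
    NormedSpace.exp (z • P) = 1 + (Complex.exp z - 1) • P := by
  have h := NormedSpace.exp_series_hasSum_exp' (𝕂 := ℂ) (z • P)
  have h1 : HasSum (fun r : ℕ => ((r.factorial : ℂ)⁻¹ • z ^ r) • P + if r = 0 then 1 - P else 0)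
      (Complex.exp z • P + (1 - P)) := by
    refine HasSum.add ?_ (hasSum_ite_eq 0 (1 - P))
    have h2 := NormedSpace.exp_series_hasSum_exp' (𝕂 := ℂ) z
    rw [← Complex.exp_eq_exp_ℂ] at h2
    exact h2.smul_const P
  have h3 : (fun r : ℕ => (r.factorial : ℂ)⁻¹ • (z • P) ^ r) =
      fun r : ℕ => ((r.factorial : ℂ)⁻¹ • z ^ r) • P + if r = 0 then 1 - P else 0 := by
    ext1 r
    -- The term of order `0` is `1 = P + (1 - P)`; all others are multiples of `P`.
    rcases r with _ | r
    · simp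
    · rw [smul_pow, hP.pow_succ_eq, smul_smul]
      simp
  rw [h3] at h
  rw [h.unique h1]
  module

/-- The one-qubit operator `e^{z (1 - X) / 2}`. -/
noncomputable def rotX (z : ℂ) : Matrix (Fin 2) (Fin 2) ℂ :=
  ((1 + Complex.exp z) / 2) • 1 + ((1 - Complex.exp z) / 2) • sigmaX

lemma exp_smul_minusProj (j : Fin n) (z : ℂ) :
    NormedSpace.exp (z • minusProj j) = tensor fun i => if i = j then rotX z else 1 := by
  rw [exp_smul_of_isIdempotentElem (minusProj_isIdempotentElem j), rotX,
    ← smul_one_add_smul_pauliX, minusProj]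
  module

lemma exp_smul_sum_minusProj (s : Finset (Fin n)) (z : ℂ) :
    NormedSpace.exp (z • ∑ j ∈ s, minusProj j) = tensor fun i => if i ∈ s then rotX z else 1 := by
  induction s using Finset.induction_on with
  | empty => simp [tensor_one]
  | insert j s hj ih =>
    rw [Finset.sum_insert hj, smul_add, Matrix.exp_add_of_commute, ih, exp_smul_minusProj,
      tensor_mul]
    · congr 1
      ext i : 1
      by_cases hi : i = j
      · subst hi
        simp [hj]
      · simp [hi]
    · exact ((Commute.sum_right _ _ _ fun i _ => minusProj_commute j i).smul_left _).smul_right _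

/-- The transverse-field mixer rotates every qubit independently. -/
lemma evolve_mixerTF (t : ℝ) :
    evolve (mixerTF n) t = tensor fun _ => rotX (-(Complex.I * (t : ℂ))) := by
  rw [evolve, mixerTF_eq_sum, exp_smul_sum_minusProj]
  simp

lemma evolve_mixerTF_periodic : Function.Periodic (evolve (mixerTF n)) (2 * Real.pi) := by
  intro t
  have h : Complex.exp (-(Complex.I * ((t + 2 * Real.pi : ℝ) : ℂ))) =
      Complex.exp (-(Complex.I * (t : ℂ))) := by
    rw [Complex.exp_eq_exp_iff_exists_int]
    exact ⟨-1, by push_cast; ring⟩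
  simp only [evolve_mixerTF, rotX, h]

lemma problemHam_eq_diagonal (C : Bits n → ℕ) :
    problemHam C = Matrix.diagonal fun x => ((Finset.univ.sup C : ℕ) : ℂ) - (C x : ℂ) := by
  rw [problemHam, costHam, costMax, Matrix.smul_one_eq_diagonal, Matrix.diagonal_sub]
  simp

lemma problemHam_isHermitian (C : Bits n → ℕ) : (problemHam C).IsHermitian := by
  rw [problemHam_eq_diagonal]
  exact Matrix.isHermitian_diagonal_of_self_adjoint _ (by ext x; simp)

/-- The phase separator has integer spectrum since the objective function is integer valued. -/
lemma evolve_problemHam_periodic (C : Bits n → ℕ) :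
    Function.Periodic (evolve (problemHam C)) (2 * Real.pi) := by
  intro t
  simp only [evolve, problemHam_eq_diagonal, ← Matrix.diagonal_smul, Matrix.exp_diagonal]
  congr 1
  ext x
  simp only [Pi.coe_exp, Pi.smul_apply, smul_eq_mul, ← Complex.exp_eq_exp_ℂ]
  rw [Complex.exp_eq_exp_iff_exists_int]
  exact ⟨(C x : ℤ) - (Finset.univ.sup C : ℕ), by push_cast; ring⟩

lemma problemHam_commute_costHam (C : Bits n → ℕ) : Commute (problemHam C) (costHam C) :=
  ((Commute.one_left _).smul_left _).sub_left (Commute.refl _)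

/-- The energy of a state is the mean of `C` under a measurement in the computational basis. -/
lemma expect_costHam (C : Bits n → ℕ) (ψ : Bits n → ℂ) :
    expect (costHam C) ψ = ∑ x, (C x : ℝ) * Complex.normSq (ψ x) := by
  rw [expect, costHam, dotProduct, Complex.re_sum]
  refine Finset.sum_congr rfl fun x _ => ?_
  rw [Matrix.mulVec_diagonal, Pi.star_apply, Complex.star_def, mul_left_comm,
    ← Complex.normSq_eq_conj_mul_self]
  simp

/-- At `t = π / 2` the phase of `|-⟩` is `-i`, and `(1 ± i) / 2` both have squared modulus `1 / 2`. -/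
lemma normSq_rotX_quarter (a b : Fin 2) :
    Complex.normSq (rotX (-(Complex.I * ((Real.pi / 2 : ℝ) : ℂ))) a b) = 1 / 2 := by
  have h : Complex.exp (-(Complex.I * ((Real.pi / 2 : ℝ) : ℂ))) = -Complex.I := by
    have h1 : -(Complex.I * ((Real.pi / 2 : ℝ) : ℂ)) = -(Real.pi / 2 * Complex.I) := by
      push_cast; ring
    rw [h1, Complex.exp_neg, Complex.exp_pi_div_two_mul_I, Complex.inv_I]
  rw [rotX, h]
  fin_cases a <;> fin_cases b <;> simp [sigmaX, Complex.normSq_apply] <;> norm_num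

/-- A quarter turn by the mixer takes a computational basis state to a state whose measurement
outcomes are uniformly distributed. -/
lemma expect_costHam_evolve_mixerTF_quarter (C : Bits n → ℕ) (x : Bits n) :
    expect (costHam C) (evolve (mixerTF n) (Real.pi / 2) *ᵥ Pi.single x 1) = costAvg C := by
  rw [expect_costHam, costAvg, Finset.sum_div]
  refine Finset.sum_congr rfl fun y _ => ?_
  rw [Matrix.mulVec_single_one, Matrix.col_apply, evolve_mixerTF, tensor, Matrix.of_apply,
    map_prod]
  simp only [normSq_rotX_quarter]
  simp [div_eq_mul_inv]

lemma expect_costHam_single (C : Bits n → ℕ) (x : Bits n) :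
    expect (costHam C) (Pi.single x 1) = C x := by
  rw [expect_costHam, Finset.sum_eq_single x]
  · simp
  · intro y _ hy
    simp [hy]
  · simp

lemma specNorm_sub_rev (A B : Op n) : specNorm (A - B) = specNorm (B - A) := by
  open scoped Matrix.Norms.L2Operator in
  rw [specNorm_eq_norm, specNorm_eq_norm, norm_sub_rev]

lemma le_costMax (C : Bits n → ℕ) (x : Bits n) : (C x : ℝ) ≤ costMax C :=
  Nat.cast_le.2 (Finset.le_sup (Finset.mem_univ x))

lemma exists_eq_costMax (C : Bits n → ℕ) : ∃ x, (C x : ℝ) = costMax C := by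
  obtain ⟨x, -, hx⟩ := Finset.exists_mem_eq_sup Finset.univ Finset.univ_nonempty C
  exact ⟨x, by rw [costMax, hx]⟩

/-- The gap between the maximum and the average costs a quarter turn of the mixer, during which
the energy changes at speed at most `‖[H_C, H_TF]‖`. -/
lemma costMax_sub_costAvg_le (C : Bits n → ℕ) :
    costMax C - costAvg C ≤ Real.pi / 2 * commNorm C := by
  obtain ⟨x, hx⟩ := exists_eq_costMax C
  have hunit : star (Pi.single x 1 : Bits n → ℂ) ⬝ᵥ Pi.single x 1 = 1 := by simp
  have h := abs_expect_evolve_sub_le mixerTF_isHermitian (costHam C) (Real.pi / 2) hunit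
  rw [expect_costHam_evolve_mixerTF_quarter, expect_costHam_single, hx, specNorm_sub_rev,
    abs_of_pos (by positivity : 0 < Real.pi / 2), abs_sub_comm] at h
  exact (le_abs_self _).trans h

end Evolution

/-! ### The round bound -/

section Rounds

variable {n : ℕ}

lemma plusState_unit : star (plusState n) ⬝ᵥ plusState n = 1 := by
  have h : ((1 / Real.sqrt (2 ^ n) : ℝ) : ℂ) * ((1 / Real.sqrt (2 ^ n) : ℝ) : ℂ) =
      ((1 / 2 ^ n : ℝ) : ℂ) := by
    rw [← Complex.ofReal_mul, div_mul_div_comm, Real.mul_self_sqrt (by positivity), one_mul]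
  simp only [dotProduct, plusState, Pi.star_apply, Complex.star_def, Complex.conj_ofReal, h]
  simp

lemma expect_costHam_plusState (C : Bits n → ℕ) : expect (costHam C) (plusState n) = costAvg C := by
  rw [expect_costHam, costAvg, Finset.sum_div]
  refine Finset.sum_congr rfl fun y _ => ?_
  rw [plusState, Complex.normSq_ofReal, div_mul_div_comm, Real.mul_self_sqrt (by positivity)]
  ring

lemma pauliX_mulVec_plusState (j : Fin n) : pauliX j *ᵥ plusState n = plusState n := by
  ext x
  simp only [Matrix.mulVec, dotProduct, plusState, ← Finset.sum_mul]
  have h : ∑ y, pauliX j x y = 1 := by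
    simp only [pauliX, tensor, Matrix.of_apply]
    rw [← Fintype.piFinset_univ, ← Finset.prod_univ_sum]
    refine Finset.prod_eq_one fun i _ => ?_
    generalize x i = a
    split_ifs
    · fin_cases a <;> simp [sigmaX]
    · simp [Matrix.one_apply]
  rw [h, one_mul]

lemma expect_mixerTF_plusState : expect (mixerTF n) (plusState n) = 0 := by
  have h : mixerTF n *ᵥ plusState n = 0 := by
    rw [mixerTF_eq_sum, Matrix.sum_mulVec]
    refine Finset.sum_eq_zero fun j _ => ?_
    rw [minusProj, Matrix.sub_mulVec, Matrix.smul_mulVec, Matrix.smul_mulVec,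
      pauliX_mulVec_plusState, Matrix.one_mulVec, sub_self]
  simp [expect, h]

lemma qaoaState_unit (C : Bits n → ℕ) (p : ℕ) (β γ : Fin p → ℝ) :
    star (qaoaState C p β γ) ⬝ᵥ qaoaState C p β γ = 1 := by
  induction p with
  | zero => exact plusState_unit
  | succ p ih =>
    exact evolve_mulVec_unit mixerTF_isHermitian _
      (evolve_mulVec_unit (problemHam_isHermitian C) _ (ih _ _))

lemma problemHam_mixerTF_commutator (C : Bits n → ℕ) :
    problemHam C * mixerTF n - mixerTF n * problemHam C =
      mixerTF n * costHam C - costHam C * mixerTF n := by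
  simp only [problemHam, sub_mul, mul_sub, smul_mul_assoc, mul_smul_comm, one_mul, mul_one]
  abel

/-- In each round `⟨H_TF⟩` moves only under the phase separator and `⟨H_C⟩` only under the mixer,
each by at most `π ‖[H_C, H_TF]‖`. -/
lemma expect_qaoaState_le (C : Bits n → ℕ) (p : ℕ) (β γ : Fin p → ℝ) :
    expect (mixerTF n) (qaoaState C p β γ) + expect (costHam C) (qaoaState C p β γ) - costAvg C ≤
      p * (2 * Real.pi * commNorm C) := by
  induction p with
  | zero =>
    simp [qaoaState, expect_mixerTF_plusState, expect_costHam_plusState]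
  | succ p ih =>
    have hφ := qaoaState_unit C p (fun i => β i.castSucc) (fun i => γ i.castSucc)
    have h0 := ih (fun i => β i.castSucc) (fun i => γ i.castSucc)
    rw [qaoaState]
    set φ := qaoaState C p (fun i => β i.castSucc) (fun i => γ i.castSucc)
    set χ := evolve (problemHam C) (γ (Fin.last p)) *ᵥ φ with hχ
    have hχu : star χ ⬝ᵥ χ = 1 := evolve_mulVec_unit (problemHam_isHermitian C) _ hφ
    have h1 : expect (costHam C) χ = expect (costHam C) φ :=
      expect_evolve_of_commute (problemHam_isHermitian C) (problemHam_commute_costHam C) _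
    have h2 := abs_expect_evolve_sub_le_pi (problemHam_isHermitian C)
      (evolve_problemHam_periodic C) (mixerTF n) (γ (Fin.last p)) hφ
    rw [← hχ, problemHam_mixerTF_commutator, specNorm_sub_rev] at h2
    have h3 : expect (mixerTF n) (evolve (mixerTF n) (β (Fin.last p)) *ᵥ χ) =
        expect (mixerTF n) χ :=
      expect_evolve_of_commute mixerTF_isHermitian (Commute.refl _) _
    have h4 := abs_expect_evolve_sub_le_pi mixerTF_isHermitian
      evolve_mixerTF_periodic (costHam C) (β (Fin.last p)) hχu
    rw [specNorm_sub_rev] at h4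
    have h5 := (le_abs_self _).trans h2
    have h6 := (le_abs_self _).trans h4
    change _ ≤ Real.pi * commNorm C at h5 h6
    rw [h3]
    push_cast
    linarith

/-- The convention `λ = 0` for `C_max = 0` is harmless, as then `C = 0`. -/
lemma approxRatio_mul_costMax (C : Bits n → ℕ) (ψ : Bits n → ℂ) :
    approxRatio C ψ * costMax C = expect (costHam C) ψ := by
  by_cases h : costMax C = 0
  · have hC : ∀ x, C x = 0 := by
      intro x
      have h1 : C x ≤ Finset.univ.sup C := Finset.le_sup (Finset.mem_univ x)
      have h2 : Finset.univ.sup C = 0 := Nat.cast_eq_zero.1 h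
      omega
    rw [h, mul_zero, expect_costHam]
    simp [hC]
  · rw [approxRatio, div_mul_cancel₀ _ h]

lemma commNorm_nonneg (C : Bits n → ℕ) : 0 ≤ commNorm C := specNorm_nonneg _

lemma roundBound_qaoaState_le (C : Bits n → ℕ) (p : ℕ) (β γ : Fin p → ℝ) :
    roundBound C (qaoaState C p β γ) ≤ p := by
  rw [roundBound, approxRatio_mul_costMax]
  have hN := commNorm_nonneg C
  have hpi := Real.pi_pos
  refine div_le_of_le_mul₀ (by positivity) (by positivity)
    ((expect_qaoaState_le C p β γ).trans ?_)
  gcongr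
  norm_num

/-- If the commutator vanishes, so does the quotient; otherwise it is at most `1 / 8`. -/
lemma gap_div_commNorm_lt_one (C : Bits n → ℕ) :
    (costMax C - costAvg C) / (4 * Real.pi * commNorm C) < 1 := by
  have hN := commNorm_nonneg C
  have hpi := Real.pi_pos
  refine (div_le_of_le_mul₀ (c := 1 / 8) (by positivity) (by norm_num) ?_).trans_lt (by norm_num)
  have := costMax_sub_costAvg_le C
  linarith

lemma sum_normSq_of_unit {ψ : Bits n → ℂ} (hψ : star ψ ⬝ᵥ ψ = 1) :
    ∑ x, Complex.normSq (ψ x) = 1 := by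
  have h : ((∑ x, Complex.normSq (ψ x) : ℝ) : ℂ) = 1 := by
    rw [← hψ, dotProduct, Complex.ofReal_sum]
    exact Finset.sum_congr rfl fun x _ => Complex.normSq_eq_conj_mul_self
  exact_mod_cast h

lemma expect_costHam_le_costMax (C : Bits n → ℕ) {ψ : Bits n → ℂ} (hψ : star ψ ⬝ᵥ ψ = 1) :
    expect (costHam C) ψ ≤ costMax C := by
  rw [expect_costHam, ← mul_one (costMax C), ← sum_normSq_of_unit hψ, Finset.mul_sum]
  refine Finset.sum_le_sum fun x _ => mul_le_mul_of_nonneg_right ?_ (Complex.normSq_nonneg _)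
  exact le_costMax C x

/-- Since `⟨H_TF⟩ ≤ n`, a gap of order `n` dominates the whole numerator of the round bound, and
the commutator norm dominates the gap. -/
lemma roundBound_le_of_gap {δ : ℝ} (hδ : 0 < δ) (C : Bits n → ℕ)
    (hgap : δ * n ≤ costMax C - costAvg C) {ψ : Bits n → ℂ} (hψ : star ψ ⬝ᵥ ψ = 1) :
    roundBound C ψ ≤ (1 / δ + 1) / 8 := by
  rw [roundBound, approxRatio_mul_costMax]
  have hN := commNorm_nonneg C
  have hpi := Real.pi_pos
  refine div_le_of_le_mul₀ (by positivity) (by positivity) ?_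
  have h1 := (le_abs_self _).trans ((abs_expect_le_specNorm (mixerTF n) hψ).trans
    specNorm_mixerTF_le)
  have h2 := expect_costHam_le_costMax C hψ
  have h3 : (n : ℝ) ≤ 1 / δ * (costMax C - costAvg C) := by
    rw [one_div, ← div_eq_inv_mul, le_div_iff₀ hδ]
    linarith
  calc _ ≤ (1 / δ + 1) * (costMax C - costAvg C) := by linarith
    _ ≤ (1 / δ + 1) * (Real.pi / 2 * commNorm C) := by
      gcongr
      exact costMax_sub_costAvg_le C
    _ = _ := by ring

end Rounds

/-! ### Characters of the Boolean cube -/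

section Parity

variable {n : ℕ}

/-- The character `x ↦ (-1) ^ ∑ j ∈ S, x j` of the Boolean cube: the diagonal of `∏ j ∈ S, Z_j`. -/
def parity (S : Finset (Fin n)) (x : Bits n) : ℝ := ∏ j ∈ S, (-1) ^ (x j : ℕ)

/-- The bit string `x` with bit `j` flipped. -/
def flipBit (j : Fin n) (x : Bits n) : Bits n := Function.update x j (x j + 1)

lemma flipBit_involutive (j : Fin n) : Function.Involutive (flipBit j) := by
  intro x
  have h : ∀ b : Fin 2, b + 1 + 1 = b := by decide
  simp [flipBit, h]

lemma parity_flipBit_of_mem {j : Fin n} {S : Finset (Fin n)} (hj : j ∈ S) (x : Bits n) :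
    parity S (flipBit j x) = -parity S x := by
  have h : ∀ b : Fin 2, (-1 : ℝ) ^ ((b + 1 : Fin 2) : ℕ) = -(-1) ^ (b : ℕ) := by
    intro b
    fin_cases b <;> simp
  rw [parity, parity, ← Finset.mul_prod_erase _ _ hj, ← Finset.mul_prod_erase _ _ hj, ← neg_mul]
  congr 1
  · simp [flipBit, h]
  · refine Finset.prod_congr rfl fun i hi => ?_
    rw [flipBit, Function.update_of_ne (Finset.ne_of_mem_erase hi)]

lemma parity_flipBit_of_notMem {j : Fin n} {S : Finset (Fin n)} (hj : j ∉ S) (x : Bits n) :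
    parity S (flipBit j x) = parity S x := by
  refine Finset.prod_congr rfl fun i hi => ?_
  rw [flipBit, Function.update_of_ne (by rintro rfl; exact hj hi)]

lemma parity_mul_self (S : Finset (Fin n)) (x : Bits n) : parity S x * parity S x = 1 := by
  rw [parity, ← Finset.prod_mul_distrib]
  refine Finset.prod_eq_one fun j _ => ?_
  rw [← mul_pow]
  simp

lemma abs_parity (S : Finset (Fin n)) (x : Bits n) : |parity S x| = 1 := by
  simp [parity, Finset.abs_prod]

lemma sum_eq_zero_of_flipBit {f : Bits n → ℝ} (j : Fin n) (hf : ∀ x, f (flipBit j x) = -f x) :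
    ∑ x, f x = 0 := by
  have h := Equiv.sum_comp (flipBit_involutive j).toPerm f
  simp only [Function.Involutive.coe_toPerm, hf, Finset.sum_neg_distrib] at h
  linarith

lemma sum_parity_eq_zero {S : Finset (Fin n)} (hS : S.Nonempty) : ∑ x, parity S x = 0 := by
  obtain ⟨j, hj⟩ := hS
  exact sum_eq_zero_of_flipBit j (parity_flipBit_of_mem hj)

lemma pauliZ_eq_diagonal (S : Finset (Fin n)) :
    pauliZ S = Matrix.diagonal fun x => (parity S x : ℂ) := by
  have hZ : ∀ (i : Fin n) (a b : Fin 2), (if i ∈ S then sigmaZ else 1) a b =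
      if a = b then (if i ∈ S then (-1 : ℂ) ^ (a : ℕ) else 1) else 0 := by
    intro i a b
    by_cases hi : i ∈ S
    · fin_cases a <;> fin_cases b <;> simp [hi, sigmaZ]
    · simp only [if_neg hi]
      exact Matrix.one_apply
  ext x y
  simp only [pauliZ, tensor, Matrix.of_apply, hZ, Matrix.diagonal_apply]
  by_cases hxy : x = y
  · subst hxy
    simp [parity, Finset.prod_ite_mem]
  · obtain ⟨i, hi⟩ := Function.ne_iff.1 hxy
    rw [if_neg hxy]
    exact Finset.prod_eq_zero (Finset.mem_univ i) (if_neg hi)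

end Parity

/-! ### Riesz products -/

section RieszProduct

variable {n : ℕ} {ι : Type*}

/-- The Riesz product `∏ i ∈ U, (1 + s i • parity (S i))`. -/
def rieszProduct (S : ι → Finset (Fin n)) (s : ι → ℝ) (U : Finset ι) (x : Bits n) : ℝ :=
  ∏ i ∈ U, (1 + s i * parity (S i) x)

lemma rieszProduct_nonneg (S : ι → Finset (Fin n)) {s : ι → ℝ} (hs : ∀ i, |s i| ≤ 1)
    (U : Finset ι) (x : Bits n) : 0 ≤ rieszProduct S s U x := by
  refine Finset.prod_nonneg fun i _ => ?_
  have h : |s i * parity (S i) x| ≤ 1 := by rw [abs_mul, abs_parity, mul_one]; exact hs i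
  linarith [(abs_le.1 h).1]

lemma rieszProduct_flipBit (S : ι → Finset (Fin n)) (s : ι → ℝ) {U : Finset ι} {j : Fin n}
    (hj : ∀ i ∈ U, j ∉ S i) (x : Bits n) :
    rieszProduct S s U (flipBit j x) = rieszProduct S s U x :=
  Finset.prod_congr rfl fun i hi => by rw [parity_flipBit_of_notMem (hj i hi)]

lemma sum_parity_mul_rieszProduct_eq_zero (S : ι → Finset (Fin n)) (s : ι → ℝ) {U : Finset ι}
    {T : Finset (Fin n)} {j : Fin n} (hjT : j ∈ T) (hj : ∀ i ∈ U, j ∉ S i) :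
    ∑ x, parity T x * rieszProduct S s U x = 0 :=
  sum_eq_zero_of_flipBit j fun x => by
    rw [parity_flipBit_of_mem hjT, rieszProduct_flipBit S s hj, neg_mul]

variable [DecidableEq ι]

lemma sum_rieszProduct {S : ι → Finset (Fin n)} (hS : ∀ i, (S i).Nonempty) (s : ι → ℝ)
    {U : Finset ι} (hU : ∀ i ∈ U, ∀ i' ∈ U, ¬Disjoint (S i) (S i') → i = i') :
    ∑ x, rieszProduct S s U x = 2 ^ n := by
  induction U using Finset.induction_on with
  | empty => simp [rieszProduct]
  | insert i U hi ih =>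
    obtain ⟨j, hj⟩ := hS i
    have hjU : ∀ i' ∈ U, j ∉ S i' := by
      intro i' hi' hj'
      have := hU i (Finset.mem_insert_self _ _) i' (Finset.mem_insert_of_mem hi')
        (Finset.not_disjoint_iff.2 ⟨j, hj, hj'⟩)
      exact hi (this ▸ hi')
    have h1 : ∀ x, rieszProduct S s (insert i U) x =
        rieszProduct S s U x + s i * (parity (S i) x * rieszProduct S s U x) := by
      intro x
      rw [rieszProduct, Finset.prod_insert hi, ← rieszProduct]
      ring
    simp only [h1, Finset.sum_add_distrib, ← Finset.mul_sum]
    rw [sum_parity_mul_rieszProduct_eq_zero S s hj hjU, mul_zero, add_zero]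
    exact ih fun a ha b hb => hU a (Finset.mem_insert_of_mem ha) b (Finset.mem_insert_of_mem hb)

/-- If no set of the family meets two of the factors, the Riesz product correlates with exactly
those characters of the family that occur as factors. -/
lemma sum_parity_mul_rieszProduct {S : ι → Finset (Fin n)} (hinj : Function.Injective S)
    (hS : ∀ i, (S i).Nonempty) (s : ι → ℝ) {U : Finset ι}
    (hU : ∀ ν, ∀ i ∈ U, ∀ i' ∈ U, ¬Disjoint (S ν) (S i) → ¬Disjoint (S ν) (S i') → i = i')
    (ν : ι) :
    ∑ x, parity (S ν) x * rieszProduct S s U x = if ν ∈ U then s ν * 2 ^ n else 0 := by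
  have hself : ∀ i, ¬Disjoint (S i) (S i) := fun i h =>
    (hS i).ne_empty (Finset.disjoint_self_iff_empty _ |>.1 h)
  have hdisj : ∀ i ∈ U, ∀ i' ∈ U, ¬Disjoint (S i) (S i') → i = i' :=
    fun i hi i' hi' h => hU i i hi i' hi' (hself i) h
  by_cases hmeet : ∃ i ∈ U, ¬Disjoint (S ν) (S i)
  · obtain ⟨i, hi, hνi⟩ := hmeet
    -- No factor other than `i` involves a qubit of `S ν` or of `S i`.
    have hout : ∀ j ∈ S ν ∪ S i, ∀ i' ∈ U.erase i, j ∉ S i' := by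
      intro j hj i' hi' hj'
      refine Finset.ne_of_mem_erase hi' ?_
      rcases Finset.mem_union.1 hj with h | h
      · exact hU ν i' (Finset.mem_of_mem_erase hi') i hi
          (Finset.not_disjoint_iff.2 ⟨j, h, hj'⟩) hνi
      · exact hdisj i' (Finset.mem_of_mem_erase hi') i hi
          (Finset.not_disjoint_iff.2 ⟨j, hj', h⟩)
    have h1 : ∀ x, parity (S ν) x * rieszProduct S s U x =
        parity (S ν) x * rieszProduct S s (U.erase i) x +
          s i * (parity (S ν) x * parity (S i) x * rieszProduct S s (U.erase i) x) := by
      intro x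
      rw [rieszProduct, ← Finset.mul_prod_erase _ _ hi, ← rieszProduct]
      ring
    obtain ⟨j, hj⟩ := hS ν
    simp only [h1, Finset.sum_add_distrib, ← Finset.mul_sum]
    rw [sum_parity_mul_rieszProduct_eq_zero S s hj
      (fun i' hi' => hout j (Finset.mem_union_left _ hj) i' hi'), zero_add]
    by_cases hνU : ν ∈ U
    · obtain rfl : i = ν := (hdisj ν hνU i hi hνi).symm
      simp only [parity_mul_self, one_mul, if_pos hνU]
      rw [sum_rieszProduct hS]
      exact fun a ha b hb =>
        hdisj a (Finset.mem_of_mem_erase ha) b (Finset.mem_of_mem_erase hb)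
    · rw [if_neg hνU]
      have hne : S ν ≠ S i := fun h => hνU (hinj h ▸ hi)
      -- A qubit in exactly one of `S ν` and `S i` makes the product of the characters odd.
      have hz : ∑ x, parity (S ν) x * parity (S i) x * rieszProduct S s (U.erase i) x = 0 := by
        obtain ⟨j, hj⟩ : ∃ j, ¬(j ∈ S ν ↔ j ∈ S i) := by
          by_contra! h
          exact hne (Finset.ext h)
        refine sum_eq_zero_of_flipBit j fun x => ?_
        by_cases hjν : j ∈ S ν
        · have hji : j ∉ S i := fun h => hj (iff_of_true hjν h)
          rw [parity_flipBit_of_mem hjν, parity_flipBit_of_notMem hji,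
            rieszProduct_flipBit S s (hout j (Finset.mem_union_left _ hjν))]
          ring
        · have hji : j ∈ S i := by
            by_contra h
            exact hj (iff_of_false hjν h)
          rw [parity_flipBit_of_notMem hjν, parity_flipBit_of_mem hji,
            rieszProduct_flipBit S s (hout j (Finset.mem_union_right _ hji))]
          ring
      rw [hz, mul_zero]
  · have hνU : ν ∉ U := fun h => hmeet ⟨ν, h, hself ν⟩
    rw [if_neg hνU]
    obtain ⟨j, hj⟩ := hS ν
    refine sum_parity_mul_rieszProduct_eq_zero S s hj fun i hi hj' => hmeet ⟨i, hi, ?_⟩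
    exact Finset.not_disjoint_iff.2 ⟨j, hj, hj'⟩

end RieszProduct

/-! ### Sparse subfamilies -/

section Selection

/-- A graph (with loops allowed) whose neighbourhoods have at most `d` elements has an independent
set containing at least the fraction `1 / d` of all vertices. -/
lemma exists_independent_card_le {ι : Type*} [Fintype ι] [DecidableEq ι] (R : ι → ι → Prop)
    [DecidableRel R] (hrefl : ∀ i, R i i) (hsymm : ∀ i i', R i i' → R i' i) (d : ℕ)
    (hd : ∀ i, (Finset.univ.filter (R i)).card ≤ d) :
    ∃ U : Finset ι, (∀ i ∈ U, ∀ i' ∈ U, R i i' → i = i') ∧ Fintype.card ι ≤ U.card * d := by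
  obtain ⟨U, hU, hmax⟩ := Finset.exists_max_image
    (Finset.univ.filter fun U : Finset ι => ∀ i ∈ U, ∀ i' ∈ U, R i i' → i = i') Finset.card
    ⟨∅, by simp⟩
  simp only [Finset.mem_filter, Finset.mem_univ, true_and] at hU hmax
  refine ⟨U, hU, ?_⟩
  -- A maximum independent set dominates every vertex.
  have hcover : (Finset.univ : Finset ι) ⊆ U.biUnion fun i => Finset.univ.filter (R i) := by
    intro ν _
    by_contra hν
    simp only [Finset.mem_biUnion, Finset.mem_filter, Finset.mem_univ, true_and, not_exists,
      not_and] at hν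
    have hνU : ν ∉ U := fun h => hν ν h (hrefl ν)
    have h := hmax (insert ν U) (by
      intro i hi i' hi' hR
      rcases Finset.mem_insert.1 hi with rfl | hiU
      · rcases Finset.mem_insert.1 hi' with rfl | hiU'
        · rfl
        · exact absurd (hsymm _ _ hR) (hν i' hiU')
      · rcases Finset.mem_insert.1 hi' with rfl | hiU'
        · exact absurd hR (hν i hiU)
        · exact hU i hiU i' hiU' hR)
    rw [Finset.card_insert_of_notMem hνU] at h
    omega
  calc Fintype.card ι = (Finset.univ : Finset ι).card := rfl
    _ ≤ _ := Finset.card_le_card hcover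
    _ ≤ U.card * d := Finset.card_biUnion_le_card_mul _ _ _ fun i _ => hd i

/-- From a family of small sets with bounded occurrence one can select a positive fraction such
that no member of the family meets two selected ones. -/
lemma exists_sparse_subfamily {k l m n : ℕ} {S : Fin m → Finset (Fin n)}
    (hS : ∀ ν, (S ν).Nonempty ∧ (S ν).card ≤ k)
    (hocc : ∀ j, (Finset.univ.filter fun ν => j ∈ S ν).card ≤ l) :
    ∃ U : Finset (Fin m),
      (∀ ν, ∀ i ∈ U, ∀ i' ∈ U, ¬Disjoint (S ν) (S i) → ¬Disjoint (S ν) (S i') → i = i') ∧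
      m ≤ U.card * ((k * l) * (k * l)) := by
  classical
  have hmeet : ∀ i, (Finset.univ.filter fun ν => ¬Disjoint (S ν) (S i)).card ≤ k * l := by
    intro i
    calc _ ≤ ((S i).biUnion fun j => Finset.univ.filter fun ν => j ∈ S ν).card := by
          refine Finset.card_le_card fun ν hν => ?_
          obtain ⟨j, hj, hj'⟩ := Finset.not_disjoint_iff.1 (Finset.mem_filter.1 hν).2
          exact Finset.mem_biUnion.2 ⟨j, hj', by simpa using hj⟩
      _ ≤ (S i).card * l := Finset.card_biUnion_le_card_mul _ _ _ fun j _ => hocc j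
      _ ≤ k * l := Nat.mul_le_mul_right _ (hS i).2
  obtain ⟨U, hU, hcard⟩ := exists_independent_card_le
    (fun i i' => ∃ ν, ¬Disjoint (S ν) (S i) ∧ ¬Disjoint (S ν) (S i'))
    (fun i => by
      have h : ¬Disjoint (S i) (S i) := fun h =>
        (hS i).1.ne_empty (Finset.disjoint_self_iff_empty _ |>.1 h)
      exact ⟨i, h, h⟩)
    (fun i i' ⟨ν, h1, h2⟩ => ⟨ν, h2, h1⟩) ((k * l) * (k * l)) (fun i => by
      calc _ ≤ ((Finset.univ.filter fun ν => ¬Disjoint (S ν) (S i)).biUnion fun ν =>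
            Finset.univ.filter fun i' => ¬Disjoint (S i') (S ν)).card := by
            refine Finset.card_le_card fun i' hi' => ?_
            obtain ⟨ν, h1, h2⟩ := (Finset.mem_filter.1 hi').2
            exact Finset.mem_biUnion.2 ⟨ν, by simpa using h1,
              by simpa [disjoint_comm] using h2⟩
        _ ≤ _ * (k * l) := Finset.card_biUnion_le_card_mul _ _ _ fun ν _ => hmeet ν
        _ ≤ _ := Nat.mul_le_mul_right _ (hmeet i))
  exact ⟨U, fun ν i hi i' hi' h1 h2 => hU i hi i' hi' ⟨ν, h1, h2⟩, by simpa using hcard⟩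

end Selection

/-! ### The gap between maximum and average -/

section Gap

variable {n m : ℕ} {C : Bits n → ℕ} {S : Fin m → Finset (Fin n)} {α : Fin m → ℝ} {c₀ : ℝ}

lemma cost_eq_of_costHam_eq
    (hC : costHam C = (c₀ : ℂ) • (1 : Op n) - ∑ ν, (α ν : ℂ) • pauliZ (S ν)) (x : Bits n) :
    (C x : ℝ) = c₀ - ∑ ν, α ν * parity (S ν) x := by
  have h := congrFun (congrFun hC x) x
  simp only [costHam, pauliZ_eq_diagonal, Matrix.diagonal_apply_eq, Matrix.sub_apply,
    Matrix.smul_apply, Matrix.one_apply_eq, Matrix.sum_apply, smul_eq_mul, mul_one] at h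
  exact_mod_cast h

lemma costAvg_eq_of_cost_eq (hS : ∀ ν, (S ν).Nonempty)
    (hC : ∀ x, (C x : ℝ) = c₀ - ∑ ν, α ν * parity (S ν) x) : costAvg C = c₀ := by
  have h : ∑ x, (C x : ℝ) = 2 ^ n * c₀ := by
    simp only [hC, Finset.sum_sub_distrib]
    rw [Finset.sum_comm]
    simp only [← Finset.mul_sum, sum_parity_eq_zero (hS _)]
    simp
  rw [costAvg, h]
  field_simp

lemma costAvg_le_costMax (C : Bits n → ℕ) : costAvg C ≤ costMax C := by
  rw [costAvg, div_le_iff₀ (by positivity)]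
  calc ∑ x, (C x : ℝ) ≤ ∑ _x : Bits n, costMax C := Finset.sum_le_sum fun x _ => le_costMax C x
    _ = _ := by simp [mul_comm]

lemma costMax_sub_costAvg_le_mul (hS : ∀ ν, (S ν).Nonempty) {b : ℝ} (hb : ∀ ν, |α ν| ≤ b)
    (hC : ∀ x, (C x : ℝ) = c₀ - ∑ ν, α ν * parity (S ν) x) :
    costMax C - costAvg C ≤ b * m := by
  obtain ⟨x, hx⟩ := exists_eq_costMax C
  rw [costAvg_eq_of_cost_eq hS hC, ← hx, hC]
  have h : |∑ ν, α ν * parity (S ν) x| ≤ ∑ _ν : Fin m, b :=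
    (Finset.abs_sum_le_sum_abs _ _).trans (Finset.sum_le_sum fun ν _ => by
      rw [abs_mul, abs_parity, mul_one]; exact hb ν)
  simp only [Finset.sum_const, Finset.card_univ, Fintype.card_fin, nsmul_eq_mul] at h
  linarith [(abs_le.1 h).1]

/-- Averaging the objective function against a Riesz product whose signs favour the selected
terms shows that its maximum exceeds its average by the total weight of these terms. -/
lemma sum_abs_le_costMax_sub_costAvg (hinj : Function.Injective S) (hS : ∀ ν, (S ν).Nonempty)
    (hC : ∀ x, (C x : ℝ) = c₀ - ∑ ν, α ν * parity (S ν) x) {U : Finset (Fin m)}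
    (hU : ∀ ν, ∀ i ∈ U, ∀ i' ∈ U, ¬Disjoint (S ν) (S i) → ¬Disjoint (S ν) (S i') → i = i') :
    ∑ ν ∈ U, |α ν| ≤ costMax C - costAvg C := by
  set s : Fin m → ℝ := fun ν => -(SignType.sign (α ν) : ℝ) with hs
  have hs1 : ∀ ν, |s ν| ≤ 1 := by
    intro ν
    rw [hs, abs_neg]
    rcases lt_trichotomy (α ν) 0 with h | h | h <;> simp [h]
  have hself : ∀ i, ¬Disjoint (S i) (S i) := fun i h =>
    (hS i).ne_empty (Finset.disjoint_self_iff_empty _ |>.1 h)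
  have hone : ∑ x, rieszProduct S s U x = 2 ^ n :=
    sum_rieszProduct hS s fun i hi i' hi' h => hU i i hi i' hi' (hself i) h
  have h1 : ∑ x, (C x : ℝ) * rieszProduct S s U x = 2 ^ n * (c₀ + ∑ ν ∈ U, |α ν|) := by
    have h2 : ∀ x, (C x : ℝ) * rieszProduct S s U x = c₀ * rieszProduct S s U x -
        ∑ ν, α ν * (parity (S ν) x * rieszProduct S s U x) := by
      intro x
      rw [hC, sub_mul, Finset.sum_mul]
      simp only [mul_assoc]
    simp only [h2, Finset.sum_sub_distrib]
    rw [Finset.sum_comm]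
    simp only [← Finset.mul_sum, hone, sum_parity_mul_rieszProduct hinj hS s hU]
    have h3 : ∀ ν, α ν * (if ν ∈ U then s ν * 2 ^ n else 0) =
        if ν ∈ U then -(2 ^ n * |α ν|) else 0 := by
      intro ν
      split_ifs
      · rw [hs, ← self_mul_sign (α ν)]; ring
      · simp
    simp only [h3, Finset.sum_ite_mem, Finset.univ_inter, Finset.sum_neg_distrib, ← Finset.mul_sum]
    ring
  have h4 : ∑ x, (C x : ℝ) * rieszProduct S s U x ≤ 2 ^ n * costMax C := by
    rw [← hone, Finset.sum_mul]
    refine Finset.sum_le_sum fun x _ => ?_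
    rw [mul_comm]
    exact mul_le_mul_of_nonneg_left (le_costMax C x) (rieszProduct_nonneg S hs1 U x)
  rw [h1] at h4
  rw [costAvg_eq_of_cost_eq hS hC]
  linarith [le_of_mul_le_mul_left h4 (by positivity)]

/-- At least `m / (k l)²` terms can be selected, each of weight at least `a`. Adding `1` to the
denominator covers `k l = 0`, in which case there are no terms. -/
lemma mul_terms_le_costMax_sub_costAvg {k l : ℕ} {a b : ℝ} (ha : 0 < a)
    (h : IsBoundedOccurrenceLocal k l a b m C) :
    a / ((k * l) * (k * l) + 1) * m ≤ costMax C - costAvg C := by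
  obtain ⟨S, α, c₀, hinj, hS, hocc, hα, hC⟩ := h
  obtain ⟨U, hU, hm⟩ := exists_sparse_subfamily hS hocc
  have h1 := sum_abs_le_costMax_sub_costAvg hinj (fun ν => (hS ν).1) (cost_eq_of_costHam_eq hC) hU
  have h2 : U.card * a ≤ ∑ ν ∈ U, |α ν| := by
    rw [← nsmul_eq_mul]
    exact Finset.card_nsmul_le_sum _ _ _ fun ν _ => (hα ν).1
  have h3 : (m : ℝ) ≤ U.card * ((k * l) * (k * l)) := by exact_mod_cast hm
  have h4 := costAvg_le_costMax C
  rw [div_mul_eq_mul_div, div_le_iff₀ (by positivity)]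
  calc a * m ≤ a * (U.card * ((k * l) * (k * l))) := by gcongr
    _ = (U.card * a) * ((k * l) * (k * l)) := by ring
    _ ≤ (costMax C - costAvg C) * ((k * l) * (k * l)) := by gcongr; exact h2.trans h1
    _ ≤ _ := by linarith

end Gap

end QAOA

theorem mainTheorem6 (k l : ℕ) (a b : ℝ) (ha : 0 < a) :
    -- `‖[H_C, H_TF]‖ = Ω(m) ≥ Ω(C_max - C_avg)`, the constants depending only on `k, l, a, b`;
    -- the round bound is a lower bound on the number of rounds, and `< 1` without `⟨H_TF⟩`
    (∃ c B c' : ℝ, 0 < c ∧ 0 < B ∧ 0 < c' ∧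
      ∀ (n m : ℕ) (C : QAOA.Bits n → ℕ), QAOA.IsBoundedOccurrenceLocal k l a b m C →
        c * m ≤ QAOA.commNorm C ∧
        QAOA.costMax C - QAOA.costAvg C ≤ B * m ∧
        c' * (QAOA.costMax C - QAOA.costAvg C) ≤ QAOA.commNorm C ∧
        (QAOA.costMax C - QAOA.costAvg C) / (4 * Real.pi * QAOA.commNorm C) < 1 ∧
        ∀ (p : ℕ) (β γ : Fin p → ℝ), QAOA.roundBound C (QAOA.qaoaState C p β γ) ≤ p) ∧
    -- with `⟨H_TF⟩` included, the round bound is `O(1)` when `C_max - C_avg = Ω(n)`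
    (∀ δ : ℝ, 0 < δ → ∃ K : ℝ, 0 < K ∧
      ∀ (n m : ℕ) (C : QAOA.Bits n → ℕ), QAOA.IsBoundedOccurrenceLocal k l a b m C →
        δ * n ≤ QAOA.costMax C - QAOA.costAvg C →
          ∀ (p : ℕ) (β γ : Fin p → ℝ), QAOA.roundBound C (QAOA.qaoaState C p β γ) ≤ K) := by
  have hpi := Real.pi_pos
  -- `c'` is the quarter-turn constant, and `c` multiplies it by the linear growth rate of the gap.
  refine ⟨⟨2 / Real.pi * (a / ((k * l) * (k * l) + 1)), |b| + 1, 2 / Real.pi, by positivity,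
    by positivity, by positivity, fun n m C h => ?_⟩, fun δ hδ => ⟨(1 / δ + 1) / 8, by positivity,
    fun n m C _ hgap p β γ => QAOA.roundBound_le_of_gap hδ C hgap (QAOA.qaoaState_unit C p β γ)⟩⟩
  have hgap : 2 / Real.pi * (QAOA.costMax C - QAOA.costAvg C) ≤ QAOA.commNorm C := by
    rw [div_mul_eq_mul_div, div_le_iff₀ hpi]
    linarith [QAOA.costMax_sub_costAvg_le C]
  refine ⟨?_, ?_, hgap, QAOA.gap_div_commNorm_lt_one C, QAOA.roundBound_qaoaState_le C⟩
  · refine le_trans ?_ hgap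
    rw [mul_assoc]
    gcongr
    exact QAOA.mul_terms_le_costMax_sub_costAvg ha h
  · obtain ⟨S, α, c₀, -, hS, -, hα, hC⟩ := h
    exact QAOA.costMax_sub_costAvg_le_mul (fun ν => (hS ν).1)
      (fun ν => (hα ν).2.trans ((le_abs_self b).trans (by linarith)))
      (QAOA.cost_eq_of_costHam_eq hC)
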